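/- For integers $n,q\ge 1$ let $Q^n=\{0,1,\dots,q\}^n$, and for $\mathbf x\in Q^n$ let $S_{\mathbf x}=\{i: x_i\neq 0\}$ be its support. A family $\mathcal F\subseteq Q^n$ is $r$-support uniform if $|S_{\mathbf x}|=r$ for every $\mathbf x\in\mathcal F$, and it is $s$-sum $t$-intersecting if $|\{i: x_i+y_i\ge s\}|\ge t$ for any two distinct $\mathbf x,\mathbf y\in\mathcal F$. Write $[m]=\{1,\dots,m\}$. Let $2\le q<s\le 2q$ and $r\ge t\ge 1$ be integers. For $n\ge r$ define the following families. (a) If $s$ is even and $T\subseteq[n]$ has $|T|=t$, let $$\mathcal F_{n,q,s,r,T}=\left\{\mathbf x\in Q^n:\ x_i\ge \tfrac s2 \text{ for all } i\in T,\ |S_{\mathbf x}|=r\right\}.$$ (b) If $s$ is odd, for every $(t-1)$-subset $T'$ of $[r]$ choose a vector $\mathbf x_{T'}\in Q^n$ with $S_{\mathbf x_{T'}}=[r]$, $(\mathbf x_{T'})_i>\frac s2$ for $i\in T'$, and $(\mathbf x_{T'})_i=\lfloor \frac s2\rfloor$ for $i\in[r]\setminus T'$, and let $$\mathcal F_{n,q,s,r,t}=\left\{\mathbf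 x_{T'}: T'\in\tbinom{[r]}{t-1}\right\}\cup\bigcup_{T\in\binom{[r]}{t}}\left\{\mathbf y\in Q^n:\ y_i>\lfloor\tfrac s2\rfloor\ (i\in T),\ y_i=\lfloor\tfrac s2\rfloor\ (i\in[\max T]\setminus T),\ |S_{\mathbf y}|=r\right\}.$$ Let $f(n,q,s,r,t)=|\mathcal F_{n,q,s,r,t}|$ (such choices exist, and the size does not depend on the choice). **Theorem.** There exists $n(q,s,r,t)$ such that if $n\ge n(q,s,r,t)$ and $\mathcal F\subseteq Q^n$ is $r$-support uniform and $s$-sum $t$-intersecting, then $$|\mathcal F|\le\begin{cases}(q-\frac s2+1)^t\,q^{r-t}\binom{n-t}{r-t} & \text{if } s \text{ is even},\\ f(n,q,s,r,t) & \text{if } s \text{ is odd}.\end{cases}$$ These bounds are best possible: for every $n\ge r$, the families in (a) (for every $T$), respectively in (b) (for every choice of the vectors $\mathbf x_{T'}$), are $r$-support uniform and $s$-sum $t$-intersecting and have exactly the stated size. -/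

import Mathlib

/-- The set `Q^n` of vectors of length `n` with entries in `Q = {0, 1, ..., q}`. -/
abbrev QVec (q n : ℕ) : Type := Fin n → Fin (q + 1)

namespace QVec

/-- The support `S_x = {i : x_i ≠ 0}`. -/
def supp {q n : ℕ} (x : QVec q n) : Finset (Fin n) :=
  Finset.univ.filter fun i => x i ≠ 0

/-- The size `|{i : x_i + y_i ≥ s}|` of the `s`-sum intersection; the sum is taken in `ℕ`. -/
def sumInter {q n : ℕ} (s : ℕ) (x y : QVec q n) : ℕ :=
  (Finset.univ.filter fun i => s ≤ (x i : ℕ) + (y i : ℕ)).card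

/-- `F` is `r`-support uniform: every member has exactly `r` nonzero entries. -/
def SupportUniform {q n : ℕ} (r : ℕ) (F : Finset (QVec q n)) : Prop :=
  ∀ x ∈ F, (supp x).card = r

/-- `F` is `s`-sum `t`-intersecting: any two distinct members have sum at least `s` in at least
`t` coordinates. -/
def SumIntersecting {q n : ℕ} (s t : ℕ) (F : Finset (QVec q n)) : Prop :=
  ∀ x ∈ F, ∀ y ∈ F, x ≠ y → t ≤ sumInter s x y

/-- The family for even `s`: all vectors with support of size `r` whose entries in `T` are at
least `s / 2`. -/
def evenFamily (n q s r : ℕ) (T : Finset (Fin n)) : Finset (QVec q n) :=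
  Finset.univ.filter fun x => (∀ i ∈ T, s / 2 ≤ (x i : ℕ)) ∧ (supp x).card = r

/-- The first `r` coordinates (the set `[r]`), numbered from `0`. -/
def firstCoords (n r : ℕ) : Finset (Fin n) :=
  Finset.univ.filter fun i => (i : ℕ) < r

/-- `pick` is an admissible choice of the vectors `x_{T'}`, for the `(t - 1)`-subsets `T'` of `[r]`:
the support of `x_{T'}` is `[r]`, its entries in `T'` exceed `s / 2`, and its entries in
`[r] \ T'` equal `⌊s / 2⌋`. -/
def IsAdmissiblePick (n q s r t : ℕ) (pick : Finset (Fin n) → QVec q n) : Prop :=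
  ∀ T' ∈ (firstCoords n r).powersetCard (t - 1),
    supp (pick T') = firstCoords n r ∧
    (∀ i ∈ T', s < 2 * (pick T' i : ℕ)) ∧
    (∀ i ∈ firstCoords n r \ T', (pick T' i : ℕ) = s / 2)

/-- The second row of the family for odd `s`: vectors `y` with support of size `r` such that for
some `t`-subset `T` of `[r]`, the entries of `y` in `T` exceed `⌊s / 2⌋`, and all entries outside
`T` that precede the largest element of `T` equal `⌊s / 2⌋`. -/
def oddFamilyMain (n q s r t : ℕ) : Finset (QVec q n) :=
  ((firstCoords n r).powersetCard t).biUnion fun T =>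
    Finset.univ.filter fun y : QVec q n =>
      (∀ i ∈ T, s / 2 < (y i : ℕ)) ∧
      (∀ i, i ∉ T → (∃ j ∈ T, i ≤ j) → (y i : ℕ) = s / 2) ∧
      (supp y).card = r

/-- The family for odd `s`, for a given choice of the vectors `x_{T'}`. -/
def oddFamily (n q s r t : ℕ) (pick : Finset (Fin n) → QVec q n) : Finset (QVec q n) :=
  ((firstCoords n r).powersetCard (t - 1)).image pick ∪ oddFamilyMain n q s r t

/-- A concrete choice of the vectors `x_{T'}`: entries `q` in `T'`, entries `⌊s / 2⌋` in `[r] \ T'`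
and `0` elsewhere (`⌊s / 2⌋` is at most `q` when `s ≤ 2 q`). -/
def standardPick (n q s r : ℕ) (T' : Finset (Fin n)) : QVec q n := fun i =>
  if i ∈ T' then Fin.last q else if (i : ℕ) < r then Fin.ofNat (q + 1) (s / 2) else 0

/-- `f(n, q, s, r, t)`: the size of the family for odd `s`. -/
def f (n q s r t : ℕ) : ℕ := (oddFamily n q s r t (standardPick n q s r)).card

end QVec

namespace QVec

section

open Finset

/-! Since q < s, a coordinate where two members sum to at least s lies in both supports. So every
member other than a fixed y is nonzero on some t-subset T of the support of y. Sort the members into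
fibers by T and by their pattern a on T. A fiber can have order n^(r-t), but only O(n^(r-t-1)) of
its members are nonzero at a given further coordinate, so a large fiber has a member vanishing on
any given r-set outside T (`exists_mem_fiber_disjoint`). Hence large fibers share the same T, and
their patterns have sums at least s throughout T (`large_fibers_compatible`); in particular their
entries are at least b = ⌈s/2⌉. If one of the (q+1-b)^t such patterns has no large fiber, its unused
share of the bound absorbs all lower-order members. Otherwise, comparison with the constant pattern
b shows that every member is at least s-b on T (`card_le_or_anchored`). For even s this gives the
bound.

For odd s = 2c+1 the anchor only gives entries at least c. Split by the set D ⊆ T of entries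
exceeding c. Within one class, sums on T \ D are 2c < s, so outside T the class is (r-t)-uniform and
(t-|D|)-intersecting, and induction on r applies (`IsRelFamily.restrict`). Distinct members may
agree outside T, hence the multiplicity `l`. It scales the main term `mainCount` only; the additive
term C(r,t-1) reassembles over D by Vandermonde. Sets D too small for the induction are counted
jointly (`card_few_large_le`). -/

/-- The vector that agrees with `x` on `U` and vanishes elsewhere. -/
def restrictTo {q n : ℕ} (U : Finset (Fin n)) (x : QVec q n) : QVec q n :=
  fun i => if i ∈ U then x i else 0

/-! ### Counting vectors with prescribed entries -/

theorem card_filter_le_val {q : ℕ} (b : ℕ) :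
    (univ.filter fun v : Fin (q + 1) => b ≤ (v : ℕ)).card = q + 1 - b := by
  have h := Fin.card_filter_val_lt (n := q + 1) (m := b)
  have h2 := Finset.card_filter_add_card_filter_not (s := (univ : Finset (Fin (q + 1))))
    (fun v => (v : ℕ) < b)
  simp only [not_lt, card_univ, Fintype.card_fin] at h2
  omega

/-- The number of vectors supported in `U`, with prescribed sets `S i` of nonzero values on `A`,
and with support of size `r`. -/
theorem card_prescribed {q n : ℕ} {U A : Finset (Fin n)} (hAU : A ⊆ U)
    (S : Fin n → Finset (Fin (q + 1))) (hS : ∀ i ∈ A, 0 ∉ S i) {r : ℕ} (hr : A.card ≤ r) :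
    (univ.filter fun w : QVec q n =>
      (∀ i, i ∉ U → w i = 0) ∧ (∀ i ∈ A, w i ∈ S i) ∧ (supp w).card = r).card =
      (∏ i ∈ A, (S i).card) * q ^ (r - A.card) * (U.card - A.card).choose (r - A.card) := by
  have hset : (univ.filter fun w : QVec q n =>
      (∀ i, i ∉ U → w i = 0) ∧ (∀ i ∈ A, w i ∈ S i) ∧ (supp w).card = r) =
      ((U \ A).powersetCard (r - A.card)).biUnion fun C =>
        Fintype.piFinset fun i => if i ∈ A then S i else if i ∈ C then univ.erase 0 else {0} := by
    ext w
    simp only [mem_filter, mem_univ, true_and, mem_biUnion, mem_powersetCard,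
      Fintype.mem_piFinset]
    constructor
    · rintro ⟨h0, hA, hc⟩
      have hAs : A ⊆ supp w := fun i hi => by
        simp only [supp, mem_filter, mem_univ, true_and]
        intro h
        exact hS i hi (h ▸ hA i hi)
      refine ⟨supp w \ A, ⟨?_, ?_⟩, fun i => ?_⟩
      · refine sdiff_subset_sdiff (fun i hi => ?_) le_rfl
        by_contra hU
        simp [supp, h0 i hU] at hi
      · rw [card_sdiff_of_subset hAs, hc]
      · by_cases hi : i ∈ A
        · simpa [hi] using hA i hi
        · by_cases hw : w i = 0 <;> simp [hi, supp, hw]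
    · rintro ⟨C, ⟨hCU, hCc⟩, hw⟩
      have hsupp : supp w = A ∪ C := by
        ext i
        have := hw i
        simp only [supp, mem_filter, mem_univ, true_and, mem_union]
        by_cases hi : i ∈ A
        · simp only [hi, if_true] at this
          simp only [hi, true_or, iff_true]
          intro h
          exact hS i hi (h ▸ this)
        · by_cases hC : i ∈ C <;> simp_all
      have hdisj : Disjoint A C :=
        disjoint_left.2 fun i hi hC => (mem_sdiff.1 (hCU hC)).2 hi
      refine ⟨fun i hi => ?_, fun i hi => ?_, ?_⟩
      · have := hw i
        have h1 : i ∉ A := fun h => hi (hAU h)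
        have h2 : i ∉ C := fun h => hi (mem_sdiff.1 (hCU h)).1
        simpa [h1, h2] using this
      · simpa [hi] using hw i
      · rw [hsupp, card_union_of_disjoint hdisj, hCc]
        omega
  rw [hset, card_biUnion]
  · have hterm : ∀ C ∈ (U \ A).powersetCard (r - A.card),
        (Fintype.piFinset fun i => if i ∈ A then S i else if i ∈ C then univ.erase 0
          else ({0} : Finset (Fin (q + 1)))).card = (∏ i ∈ A, (S i).card) * q ^ (r - A.card) := by
      intro C hC
      obtain ⟨hCU, hCc⟩ := mem_powersetCard.1 hC
      have hdisj : Disjoint A C :=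
        disjoint_left.2 fun i hi hC => (mem_sdiff.1 (hCU hC)).2 hi
      rw [Fintype.card_piFinset, ← prod_subset (subset_univ (A ∪ C)), prod_union hdisj, ← hCc,
        ← prod_const]
      · congr 1
        · exact prod_congr rfl fun i hi => by simp [hi]
        · refine prod_congr rfl fun i hi => ?_
          have : i ∉ A := fun h => disjoint_left.1 hdisj h hi
          simp [this, hi]
      · intro i _ hi
        rw [mem_union, not_or] at hi
        simp [hi.1, hi.2]
    rw [sum_congr rfl hterm, sum_const, card_powersetCard, card_sdiff_of_subset hAU, smul_eq_mul,
      mul_comm]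
  · intro C hC D hD hCD
    simp only [Function.onFun]
    rw [disjoint_left]
    intro w h1 h2
    apply hCD
    simp only [Fintype.mem_piFinset] at h1 h2
    have hC' := (mem_powersetCard.1 hC).1
    have hD' := (mem_powersetCard.1 hD).1
    ext i
    have a1 := h1 i
    have a2 := h2 i
    by_cases hi : i ∈ A
    · exact ⟨fun h => absurd hi (mem_sdiff.1 (hC' h)).2, fun h => absurd hi (mem_sdiff.1 (hD' h)).2⟩
    · by_cases c1 : i ∈ C <;> by_cases c2 : i ∈ D <;> simp_all

/-! ### Families relative to a coordinate set -/

/-- The family `F` is `r`-uniform and `s`-sum `t`-intersecting on the coordinates in `U`, and every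
vector on `U` is the restriction of at most `l` members of `F`. -/
structure IsRelFamily {q n : ℕ} (s r t l : ℕ) (U : Finset (Fin n)) (F : Finset (QVec q n)) :
    Prop where
  uniform : ∀ x ∈ F, (U.filter fun i => x i ≠ 0).card = r
  -- Distinctness refers to the whole vectors: members that agree on `U` must still satisfy this.
  -- This keeps the additive term of the odd bound free of `l`.
  inter : ∀ x ∈ F, ∀ y ∈ F, x ≠ y → t ≤ (U.filter fun i => s ≤ (x i : ℕ) + (y i : ℕ)).card
  mult : ∀ w : QVec q n, (F.filter fun x => ∀ i ∈ U, x i = w i).card ≤ l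

theorem card_le_of_restrictTo_mem {q n l : ℕ} {U : Finset (Fin n)} {F G : Finset (QVec q n)}
    (hm : ∀ w : QVec q n, (F.filter fun x => ∀ i ∈ U, x i = w i).card ≤ l)
    (hG : ∀ x ∈ F, restrictTo U x ∈ G) : F.card ≤ l * G.card := by
  refine card_le_mul_card_image_of_maps_to hG l fun w _ => le_trans (card_le_card ?_) (hm w)
  intro x hx
  rw [mem_filter] at hx ⊢
  refine ⟨hx.1, fun i hi => ?_⟩
  rw [← hx.2]
  simp [restrictTo, hi]

theorem supp_restrictTo {q n : ℕ} (U : Finset (Fin n)) (x : QVec q n) :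
    supp (restrictTo U x) = U.filter fun i => x i ≠ 0 := by
  ext i
  by_cases hi : i ∈ U <;> simp [supp, restrictTo, hi]

theorem card_le_of_prescribed {q n r l : ℕ} {U A : Finset (Fin n)} {F : Finset (QVec q n)}
    (hu : ∀ x ∈ F, (U.filter fun i => x i ≠ 0).card = r)
    (hm : ∀ w : QVec q n, (F.filter fun x => ∀ i ∈ U, x i = w i).card ≤ l)
    (hAU : A ⊆ U) (S : Fin n → Finset (Fin (q + 1))) (hS : ∀ i ∈ A, 0 ∉ S i) (hr : A.card ≤ r)
    (hF : ∀ x ∈ F, ∀ i ∈ A, x i ∈ S i) :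
    F.card ≤
      l * ((∏ i ∈ A, (S i).card) * q ^ (r - A.card) * (U.card - A.card).choose (r - A.card)) := by
  rw [← card_prescribed hAU S hS hr]
  refine card_le_of_restrictTo_mem hm fun x hx => ?_
  rw [mem_filter]
  refine ⟨mem_univ _, fun i hi => by simp [restrictTo, hi], fun i hi => ?_, ?_⟩
  · simpa [restrictTo, hAU hi] using hF x hx i hi
  · rw [supp_restrictTo, hu x hx]

theorem IsRelFamily.mono {q n s r t l : ℕ} {U : Finset (Fin n)} {F G : Finset (QVec q n)}
    (h : IsRelFamily s r t l U F) (hG : G ⊆ F) : IsRelFamily s r t l U G where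
  uniform x hx := h.uniform x (hG hx)
  inter x hx y hy := h.inter x (hG hx) y (hG hy)
  mult w := (card_le_card (filter_subset_filter _ hG)).trans (h.mult w)

theorem ne_zero_of_le_add {q n s : ℕ} (hqs : q < s) {x y : QVec q n} {i : Fin n}
    (h : s ≤ (x i : ℕ) + (y i : ℕ)) : x i ≠ 0 ∧ y i ≠ 0 := by
  have hx := (x i).is_le
  have hy := (y i).is_le
  constructor <;> intro h0 <;> simp only [h0, Fin.val_zero] at h <;> omega

/-! ### Fibers and large fibers -/

/-- The members of `F` that agree with `a` on `T`. -/
def fiber {q n : ℕ} (F : Finset (QVec q n)) (T : Finset (Fin n)) (a : QVec q n) :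
    Finset (QVec q n) :=
  F.filter fun x => ∀ i ∈ T, x i = a i

/-- Forcing one more nonzero coordinate lowers the degree in `U.card` by one. This is the scale
against which a fiber counts as large. -/
theorem card_filter_fiber_ne_zero_le {q n r l : ℕ} {U T : Finset (Fin n)} {F : Finset (QVec q n)}
    (hu : ∀ x ∈ F, (U.filter fun i => x i ≠ 0).card = r)
    (hm : ∀ w : QVec q n, (F.filter fun x => ∀ i ∈ U, x i = w i).card ≤ l)
    (hTU : T ⊆ U) (hT : T.card < r) {a : QVec q n} (ha : ∀ i ∈ T, a i ≠ 0) {j : Fin n}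
    (hjU : j ∈ U) (hjT : j ∉ T) :
    ((fiber F T a).filter fun x => x j ≠ 0).card ≤
      l * (q ^ (r - T.card) * (U.card - T.card - 1).choose (r - T.card - 1)) := by
  have hsub : (fiber F T a).filter (fun x => x j ≠ 0) ⊆ F :=
    (filter_subset _ _).trans (filter_subset _ _)
  have hcard : (insert j T).card = T.card + 1 := card_insert_of_notMem hjT
  refine (card_le_of_prescribed (A := insert j T) (fun x hx => hu x (hsub hx))
    (fun w => (card_le_card (filter_subset_filter _ hsub)).trans (hm w))
    (insert_subset hjU hTU) (fun i => if i ∈ T then {a i} else univ.erase 0) ?_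
    (by omega) ?_).trans ?_
  · intro i hi
    by_cases hiT : i ∈ T
    · simpa [hiT] using (ha i hiT).symm
    · simp [hiT]
  · intro x hx i hi
    rw [mem_filter, fiber, mem_filter] at hx
    by_cases hiT : i ∈ T
    · simpa [hiT] using hx.1.2 i hiT
    · have : i = j := by simpa [hiT] using hi
      subst this
      simpa [hiT] using hx.2
  · have hprod : ∏ i ∈ insert j T,
        (if i ∈ T then {a i} else (univ.erase 0 : Finset (Fin (q + 1)))).card = q := by
      rw [prod_insert hjT, prod_eq_one fun i hi => by simp [hi]]
      simp [hjT]
    have hpow : q ^ (r - T.card) = q * q ^ (r - (T.card + 1)) := by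
      rw [← pow_succ']
      congr 1
      omega
    rw [hprod, hcard, hpow, Nat.sub_sub, Nat.sub_sub]

/-- Each of the at most `r` coordinates of `Z` outside `T` spoils few members of the fiber, and the
summand 1 pays for excluding `x0`. -/
theorem exists_mem_fiber_disjoint {q n r l : ℕ} {U T : Finset (Fin n)} {F : Finset (QVec q n)}
    (hu : ∀ x ∈ F, (U.filter fun i => x i ≠ 0).card = r)
    (hm : ∀ w : QVec q n, (F.filter fun x => ∀ i ∈ U, x i = w i).card ≤ l)
    (hTU : T ⊆ U) (hT : T.card < r) {a : QVec q n} (ha : ∀ i ∈ T, a i ≠ 0)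
    {Z : Finset (Fin n)} (hZ : Z.card ≤ r) (hZU : Z ⊆ U) (x0 : QVec q n)
    (hbig : r * (l * (q ^ (r - T.card) * (U.card - T.card - 1).choose (r - T.card - 1))) + 1 <
      (fiber F T a).card) :
    ∃ x ∈ F, (∀ i ∈ T, x i = a i) ∧ x ≠ x0 ∧ ∀ j ∈ Z, x j ≠ 0 → j ∈ T := by
  by_contra hcon
  push Not at hcon
  have hcov : fiber F T a ⊆
      insert x0 ((Z \ T).biUnion fun j => (fiber F T a).filter fun x => x j ≠ 0) := by
    intro x hx
    have hx' := hx
    rw [fiber, mem_filter] at hx'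
    by_cases hx0 : x = x0
    · simp [hx0]
    · obtain ⟨j, hjZ, hj0, hjT⟩ := hcon x hx'.1 hx'.2 hx0
      refine mem_insert_of_mem (mem_biUnion.2 ⟨j, mem_sdiff.2 ⟨hjZ, hjT⟩, ?_⟩)
      exact mem_filter.2 ⟨hx, hj0⟩
  have h1 := (card_le_card hcov).trans (card_insert_le _ _)
  have h2 := card_biUnion_le_card_mul (Z \ T) (fun j => (fiber F T a).filter fun x => x j ≠ 0) _
    fun j hj => card_filter_fiber_ne_zero_le hu hm hTU hT ha (hZU (mem_sdiff.1 hj).1)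
      (mem_sdiff.1 hj).2
  have h3 := Nat.mul_le_mul_right
    (l * (q ^ (r - T.card) * (U.card - T.card - 1).choose (r - T.card - 1)))
    ((card_le_card sdiff_subset).trans hZ : (Z \ T).card ≤ r)
  omega

/-- The vectors vanishing outside `T` whose entries in `T` are at least `b`. -/
def patterns {n : ℕ} (q : ℕ) (b : ℕ) (T : Finset (Fin n)) : Finset (QVec q n) :=
  Fintype.piFinset fun i => if i ∈ T then univ.filter (fun v => b ≤ (v : ℕ)) else {0}

theorem mem_patterns {q n b : ℕ} {T : Finset (Fin n)} {a : QVec q n} :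
    a ∈ patterns q b T ↔ (∀ i ∈ T, b ≤ (a i : ℕ)) ∧ ∀ i, i ∉ T → a i = 0 := by
  simp only [patterns, Fintype.mem_piFinset]
  constructor
  · intro h
    exact ⟨fun i hi => by simpa [hi] using h i, fun i hi => by simpa [hi] using h i⟩
  · rintro ⟨h1, h2⟩ i
    by_cases hi : i ∈ T
    · simpa [hi] using h1 i hi
    · simpa [hi] using h2 i hi

theorem card_patterns {q n b : ℕ} (T : Finset (Fin n)) :
    (patterns q b T).card = (q + 1 - b) ^ T.card := by
  rw [patterns, Fintype.card_piFinset, ← prod_subset (subset_univ T), ← prod_const]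
  · refine prod_congr rfl fun i hi => ?_
    simp only [hi, if_true]
    exact card_filter_le_val b
  · intro i _ hi
    simp [hi]

/-- Apart from a single member, an intersecting family is covered by the fibers over the
`t`-subsets of one support. -/
theorem exists_fiber_of_mem {q n s r t l : ℕ} (hqs : q < s) {U : Finset (Fin n)}
    {F : Finset (QVec q n)} (hF : IsRelFamily s r t l U F) {x y : QVec q n} (hx : x ∈ F)
    (hy : y ∈ F) (hxy : x ≠ y) :
    ∃ T ∈ (U.filter fun i => y i ≠ 0).powersetCard t, ∃ a ∈ patterns q 1 T, x ∈ fiber F T a := by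
  obtain ⟨T, hT, hTc⟩ := exists_subset_card_eq (hF.inter x hx y hy hxy)
  have hsum : ∀ i ∈ T, i ∈ U ∧ s ≤ (x i : ℕ) + (y i : ℕ) := fun i hi => by
    simpa using hT hi
  refine ⟨T, mem_powersetCard.2 ⟨fun i hi => ?_, hTc⟩, restrictTo T x, ?_, ?_⟩
  · exact mem_filter.2 ⟨(hsum i hi).1, (ne_zero_of_le_add hqs (hsum i hi).2).2⟩
  · refine mem_patterns.2 ⟨fun i hi => ?_, fun i hi => by simp [restrictTo, hi]⟩
    have := (ne_zero_of_le_add hqs (hsum i hi).2).1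
    simp only [restrictTo, hi, if_true]
    exact Nat.one_le_iff_ne_zero.2 fun h => this (Fin.ext h)
  · exact mem_filter.2 ⟨hx, fun i hi => by simp [restrictTo, hi]⟩

/-- The ratio of the two binomials is m / k, which is at least e. -/
theorem mul_choose_pred_le_choose {m k e : ℕ} (hk : 1 ≤ k) (hm : k * e ≤ m) (hm1 : 1 ≤ m) :
    e * (m - 1).choose (k - 1) ≤ m.choose k := by
  obtain ⟨k, rfl⟩ : ∃ k', k = k' + 1 := ⟨k - 1, by omega⟩
  obtain ⟨m, rfl⟩ : ∃ m', m = m' + 1 := ⟨m - 1, by omega⟩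
  have h := Nat.add_one_mul_choose_eq m k
  simp only [Nat.add_sub_cancel]
  have h2 := Nat.mul_le_mul_right (m.choose k) hm
  refine Nat.le_of_mul_le_mul_left (c := k + 1) ?_ (by omega)
  calc (k + 1) * (e * m.choose k) = (k + 1) * e * m.choose k := by ring
    _ ≤ (m + 1) * m.choose k := h2
    _ = (k + 1) * (m + 1).choose (k + 1) := by rw [h]; ring

/-- Two large fibers have the same base set, and their patterns have large sums on it. -/
theorem large_fibers_compatible {q n s r t l : ℕ} (hqs : q < s) (htr : t < r)
    {U : Finset (Fin n)} {F : Finset (QVec q n)} (hF : IsRelFamily s r t l U F)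
    {T T' : Finset (Fin n)} (hTU : T ⊆ U) (hTU' : T' ⊆ U) (hT : T.card = t) (hT' : T'.card = t)
    {a a' : QVec q n} (ha : a ∈ patterns q 1 T) (ha' : a' ∈ patterns q 1 T')
    (hbig : r * (l * (q ^ (r - t) * (U.card - t - 1).choose (r - t - 1))) + 1 <
      (fiber F T a).card)
    (hbig' : r * (l * (q ^ (r - t) * (U.card - t - 1).choose (r - t - 1))) + 1 <
      (fiber F T' a').card) :
    T = T' ∧ ∀ i ∈ T, s ≤ (a i : ℕ) + (a' i : ℕ) := by
  have hne : ∀ {T : Finset (Fin n)} {a : QVec q n}, a ∈ patterns q 1 T → ∀ i ∈ T, a i ≠ 0 := by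
    intro T a ha i hi h
    have := (mem_patterns.1 ha).1 i hi
    simp [h] at this
  -- `x` vanishes on T' \ T, then `y` vanishes on the support of `x` outside T', so the supports
  -- meet only within T ∩ T'. The excluded vector 0 plays no role.
  obtain ⟨x, hxF, hxa, -, hxd⟩ := exists_mem_fiber_disjoint hF.uniform hF.mult hTU (hT ▸ htr)
    (hne ha) (hT'.trans_le htr.le) hTU' 0 (by rwa [hT])
  obtain ⟨y, hyF, hya, hyx, hyd⟩ := exists_mem_fiber_disjoint hF.uniform hF.mult hTU' (hT' ▸ htr)
    (hne ha') (hF.uniform x hxF).le (filter_subset _ _) x (by rwa [hT'])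
  have hsub : (U.filter fun i => s ≤ (x i : ℕ) + (y i : ℕ)) ⊆ T ∩ T' := by
    intro i hi
    obtain ⟨hiU, hs⟩ := mem_filter.1 hi
    obtain ⟨hx0, hy0⟩ := ne_zero_of_le_add hqs hs
    have h' := hyd i (mem_filter.2 ⟨hiU, hx0⟩) hy0
    exact mem_inter.2 ⟨hxd i h' hx0, h'⟩
  have hc := hF.inter x hxF y hyF hyx.symm
  have hTT : T ∩ T' = T := eq_of_subset_of_card_le inter_subset_left
    (hT.le.trans (hc.trans (card_le_card hsub)))
  have hTT' : T ∩ T' = T' := eq_of_subset_of_card_le inter_subset_right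
    (hT'.le.trans (hc.trans (card_le_card hsub)))
  have heq := eq_of_subset_of_card_le hsub
    ((card_le_card inter_subset_left).trans (hT.le.trans hc))
  refine ⟨hTT.symm.trans hTT', fun i hi => ?_⟩
  rw [← hTT, ← heq] at hi
  have h1 : i ∈ T := (mem_inter.1 (hsub hi)).1
  have h2 : i ∈ T' := (mem_inter.1 (hsub hi)).2
  rw [← hxa i h1, ← hya i h2]
  exact (mem_filter.1 hi).2

/-! ### The dichotomy: small or anchored -/

/-- For large `U`, a family is either small or anchored: all its members have entries at
least `s - b` on some `t`-set. -/
theorem card_le_or_anchored {q s b : ℕ} (hqs : q < s) (hb : b ≤ q) (hsb : s ≤ 2 * b)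
    (hbs : 2 * b ≤ s + 1) {r t : ℕ} (htr : t < r) {l : ℕ} (hl : 1 ≤ l) :
    ∃ N : ℕ, ∀ (n : ℕ) (U : Finset (Fin n)) (F : Finset (QVec q n)), N ≤ U.card →
      IsRelFamily s r t l U F →
      F.card ≤ l * ((q + 1 - b) ^ t * q ^ (r - t) * (U.card - t).choose (r - t)) ∨
      ∃ T ⊆ U, T.card = t ∧ ∀ z ∈ F, ∀ i ∈ T, s ≤ (z i : ℕ) + b := by
  -- With c the binomial (U.card - t - 1).choose (r - t - 1), `e * c` dominates `y` together with
  -- all fibers of size at most `K`: at most r.choose t base sets, q ^ t patterns each. The summand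
  -- `(r - t) * e` of the threshold makes `e * c` at most the leading binomial.
  set e := 1 + r.choose t * (q ^ t * (r * (l * q ^ (r - t)) + 1)) with he
  refine ⟨r + 1 + t + (r - t) * e, fun n U F hN hF => ?_⟩
  set L := q ^ (r - t) * (U.card - t).choose (r - t) with hL
  set K := r * (l * (q ^ (r - t) * (U.card - t - 1).choose (r - t - 1))) + 1 with hK
  have hq1 : 1 ≤ q := by omega
  have hsmall : 1 + r.choose t * (q ^ t * K) ≤ l * L := by
    set c := (U.card - t - 1).choose (r - t - 1) with hc
    have hc1 : 1 ≤ c := Nat.choose_pos (by omega)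
    have h1 : e * c ≤ (U.card - t).choose (r - t) :=
      mul_choose_pred_le_choose (by omega) (by omega) (by omega)
    have h2 : K ≤ (r * (l * q ^ (r - t)) + 1) * c := by
      rw [hK]
      nlinarith
    calc 1 + r.choose t * (q ^ t * K)
        ≤ c + r.choose t * (q ^ t * ((r * (l * q ^ (r - t)) + 1) * c)) := by gcongr
      _ = e * c := by rw [he]; ring
      _ ≤ (U.card - t).choose (r - t) := h1
      _ ≤ l * L := by
        rw [hL, ← mul_assoc]
        exact Nat.le_mul_of_pos_left _ (Nat.mul_pos hl (Nat.pow_pos hq1))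
  rcases F.eq_empty_or_nonempty with rfl | ⟨y, hy⟩
  · left; simp
  set Y := U.filter fun i => y i ≠ 0 with hY
  have hYc : Y.card = r := hF.uniform y hy
  have hYU : Y ⊆ U := filter_subset _ _
  -- the members outside large fibers
  set R := insert y ((Y.powersetCard t).biUnion fun T =>
    ((patterns q 1 T).filter fun a => (fiber F T a).card ≤ K).biUnion fun a => fiber F T a) with hR
  have hRc : R.card ≤ l * L := by
    refine le_trans ?_ hsmall
    refine (card_insert_le _ _).trans ?_
    rw [add_comm]
    gcongr
    have : (Y.powersetCard t).card = r.choose t := by rw [card_powersetCard, hYc]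
    rw [← this]
    refine card_biUnion_le_card_mul _ _ _ fun T hT => ?_
    have hT' : (patterns q 1 T).card = q ^ t := by
      rw [card_patterns, (mem_powersetCard.1 hT).2]
      simp
    refine (card_biUnion_le_card_mul _ _ K fun a ha => (mem_filter.1 ha).2).trans ?_
    rw [← hT']
    exact Nat.mul_le_mul_right _ (card_le_card (filter_subset _ _))
  have hcov : ∀ x ∈ F, x ∉ R → ∃ T ∈ Y.powersetCard t, ∃ a ∈ patterns q 1 T,
      x ∈ fiber F T a ∧ K < (fiber F T a).card := by
    intro x hx hxR
    rw [hR, mem_insert, not_or] at hxR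
    obtain ⟨T, hT, a, ha, hxa⟩ := exists_fiber_of_mem hqs hF hx hy hxR.1
    refine ⟨T, hT, a, ha, hxa, ?_⟩
    by_contra hle
    exact hxR.2 (mem_biUnion.2 ⟨T, hT, mem_biUnion.2
      ⟨a, mem_filter.2 ⟨ha, not_lt.1 hle⟩, hxa⟩⟩)
  by_cases hFR : F ⊆ R
  · left
    rw [mul_assoc, ← hL]
    refine (card_le_card hFR).trans (hRc.trans ?_)
    gcongr
    exact Nat.le_mul_of_pos_left _ (Nat.pow_pos (by omega))
  obtain ⟨x₀, hx₀, hx₀R⟩ := not_subset.1 hFR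
  obtain ⟨T, hT, a₀, ha₀, -, hbig₀⟩ := hcov x₀ hx₀ hx₀R
  obtain ⟨hTY, hTc⟩ := mem_powersetCard.1 hT
  have hTU := hTY.trans hYU
  have hsub1 : patterns q b T ⊆ patterns q 1 T := fun a ha => by
    rw [mem_patterns] at ha ⊢
    exact ⟨fun i hi => le_trans (by omega) (ha.1 i hi), ha.2⟩
  by_cases hall : ∀ a ∈ patterns q b T, K < (fiber F T a).card
  · right
    refine ⟨T, hTU, hTc, fun z hz => ?_⟩
    set a : QVec q n := fun i => if i ∈ T then ⟨b, by omega⟩ else 0 with ha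
    have haT : ∀ i ∈ T, (a i : ℕ) = b := fun i hi => by simp [ha, hi]
    have hap : a ∈ patterns q b T :=
      mem_patterns.2 ⟨fun i hi => (haT i hi).ge, fun i hi => by simp [ha, hi]⟩
    -- A member with pattern `b` that vanishes on the support of `z` outside `T` can meet `z` only
    -- in `T`, hence in all of `T`.
    obtain ⟨x, hxF, hxa, hxz, hxd⟩ := exists_mem_fiber_disjoint (a := a) hF.uniform hF.mult hTU
      (hTc ▸ htr) (fun i hi h => by
        have h1 := haT i hi
        rw [h, Fin.val_zero] at h1
        omega)
      (hF.uniform z hz).le (filter_subset _ _) z (by rw [hTc]; exact hall a hap)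
    have hsub : (U.filter fun i => s ≤ (x i : ℕ) + (z i : ℕ)) ⊆ T := by
      intro i hi
      obtain ⟨hiU, hs⟩ := mem_filter.1 hi
      obtain ⟨hx0, hz0⟩ := ne_zero_of_le_add hqs hs
      exact hxd i (mem_filter.2 ⟨hiU, hz0⟩) hx0
    have heq := eq_of_subset_of_card_le hsub (hTc.le.trans (hF.inter x hxF z hz hxz))
    intro i hi
    have h1 := haT i hi
    rw [← hxa i hi] at h1
    rw [← heq] at hi
    have := (mem_filter.1 hi).2
    omega
  · left
    push Not at hall
    obtain ⟨a₁, ha₁, hsm⟩ := hall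
    -- At most `l * L` members lie in each remaining fiber, and `R`, also of size at most `l * L`,
    -- takes the place of the fiber of `a₁`.
    have hcov' : F ⊆ R ∪ ((patterns q b T).erase a₁).biUnion (fiber F T) := by
      intro x hx
      by_cases hxR : x ∈ R
      · exact mem_union_left _ hxR
      · refine mem_union_right _ ?_
        obtain ⟨T', hT', a, ha, hxa, hbig⟩ := hcov x hx hxR
        have hT'c := (mem_powersetCard.1 hT').2
        have hT'U := (mem_powersetCard.1 hT').1.trans hYU
        obtain ⟨rfl, -⟩ :=
          large_fibers_compatible hqs htr hF hTU hT'U hTc hT'c ha₀ ha hbig₀ hbig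
        -- A large fiber is compatible with itself, so 2 a_i ≥ s, and 2b ≤ s + 1 then gives a_i ≥ b.
        have hself := (large_fibers_compatible hqs htr hF hTU hTU hTc hTc ha ha hbig hbig).2
        refine mem_biUnion.2 ⟨a, mem_erase.2 ⟨?_, mem_patterns.2 ⟨fun i hi => ?_,
          (mem_patterns.1 ha).2⟩⟩, hxa⟩
        · rintro rfl
          omega
        · have := hself i hi
          omega
    have hfib : ∀ a ∈ (patterns q b T).erase a₁, (fiber F T a).card ≤ l * L := by
      intro a ha
      have ha' := (mem_patterns.1 (hsub1 (mem_of_mem_erase ha))).1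
      have hsubF : fiber F T a ⊆ F := filter_subset _ _
      have := card_le_of_prescribed (A := T) (hF.mono hsubF).uniform (hF.mono hsubF).mult hTU
        (fun i => {a i}) (fun i hi => by
          have := ha' i hi
          rw [mem_singleton]
          intro h
          rw [← h, Fin.val_zero] at this
          omega) (by omega)
        (fun x hx i hi => by simpa using (mem_filter.1 hx).2 i hi)
      simpa [hTc, hL] using this
    have h1 := (card_le_card hcov').trans (card_union_le _ _)
    have h2 := card_biUnion_le_card_mul _ _ _ hfib
    rw [card_erase_of_mem ha₁, card_patterns, hTc] at h2
    have hpos : 1 ≤ (q + 1 - b) ^ t := Nat.pow_pos (by omega)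
    obtain ⟨p, hp⟩ : ∃ p, (q + 1 - b) ^ t = p + 1 := ⟨(q + 1 - b) ^ t - 1, by omega⟩
    rw [mul_assoc, ← hL, hp]
    rw [hp, Nat.add_sub_cancel] at h2
    calc F.card ≤ l * L + p * (l * L) := by omega
      _ = l * ((p + 1) * L) := by ring

theorem isRelFamily_univ {q n s r t : ℕ} {F : Finset (QVec q n)} (hu : SupportUniform r F)
    (hi : SumIntersecting s t F) : IsRelFamily s r t 1 univ F where
  uniform := hu
  inter := hi
  mult w := card_le_one.2 fun x hx y hy => by
    rw [mem_filter] at hx hy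
    funext i
    rw [hx.2 i (mem_univ i), hy.2 i (mem_univ i)]

/-! ### The case of even s -/

/-- If `r = t`, all members of the family have the same support, and any two of them
have large sums on it. -/
theorem exists_common_support {q n s t l : ℕ} (hqs : q < s) {U : Finset (Fin n)}
    {F : Finset (QVec q n)} (hF : IsRelFamily s t t l U F) {y : QVec q n} (hy : y ∈ F) :
    (∀ x ∈ F, (U.filter fun i => x i ≠ 0) = U.filter fun i => y i ≠ 0) ∧
      ∀ x ∈ F, ∀ x' ∈ F, x ≠ x' → ∀ i ∈ U, y i ≠ 0 → s ≤ (x i : ℕ) + (x' i : ℕ) := by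
  have key : ∀ x ∈ F, ∀ x' ∈ F, x ≠ x' →
      (U.filter fun i => s ≤ (x i : ℕ) + (x' i : ℕ)) = U.filter fun i => x i ≠ 0 := by
    intro x hx x' hx' hne
    refine eq_of_subset_of_card_le (fun i hi => ?_)
      ((hF.uniform x hx).le.trans (hF.inter x hx x' hx' hne))
    rw [mem_filter] at hi ⊢
    exact ⟨hi.1, (ne_zero_of_le_add hqs hi.2).1⟩
  have hsupp : ∀ x ∈ F, (U.filter fun i => x i ≠ 0) = U.filter fun i => y i ≠ 0 := by
    intro x hx
    rcases eq_or_ne x y with rfl | hxy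
    · rfl
    · rw [← key x hx y hy hxy, ← key y hy x hx hxy.symm]
      simp only [add_comm]
  refine ⟨hsupp, fun x hx x' hx' hne i hiU hi => ?_⟩
  have : i ∈ U.filter fun i => y i ≠ 0 := mem_filter.2 ⟨hiU, hi⟩
  rw [← hsupp x hx, ← key x hx x' hx' hne] at this
  exact (mem_filter.1 this).2

theorem card_evenFamily {n q s r t : ℕ} (hs : 2 ≤ s) (hsq : s ≤ 2 * q) (htr : t ≤ r)
    {T : Finset (Fin n)} (hT : T.card = t) :
    (evenFamily n q s r T).card =
      (q - s / 2 + 1) ^ t * q ^ (r - t) * (n - t).choose (r - t) := by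
  have h := card_prescribed (q := q) (U := univ) (subset_univ T)
    (fun _ => univ.filter fun v => s / 2 ≤ (v : ℕ))
    (fun i _ => by simp only [mem_filter, mem_univ, true_and, Fin.val_zero]; omega)
    (hT.trans_le htr)
  rw [prod_const, card_filter_le_val, hT, card_univ, Fintype.card_fin] at h
  rw [show q - s / 2 + 1 = q + 1 - s / 2 by omega, ← h, evenFamily]
  congr 1
  ext x
  simp

/-- Raising every entry on the common support to at least c = s/2 is injective: if two distinct
members became equal at a coordinate with both entries at most c, their sum, at least 2c, would
force both to be c already. -/
theorem card_le_of_even_of_eq {q n s t : ℕ} (hqs : q < s) (hs : s ≤ 2 * q) (hev : Even s)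
    {F : Finset (QVec q n)} (hF : IsRelFamily s t t 1 univ F) :
    F.card ≤ (q - s / 2 + 1) ^ t := by
  obtain ⟨c, rfl⟩ := hev
  rw [show q - (c + c) / 2 + 1 = q + 1 - c by omega]
  have hpos : 1 ≤ (q + 1 - c) ^ t := Nat.pow_pos (by omega)
  rcases Nat.lt_or_ge 1 F.card with h1 | h1
  · obtain ⟨y, hy⟩ := card_pos.1 (lt_trans one_pos h1)
    obtain ⟨hsupp, hsum⟩ := exists_common_support hqs hF hy
    have hTc := hF.uniform y hy
    set T := univ.filter fun i => y i ≠ 0 with hT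
    have hc : c < q + 1 := by omega
    have hzero : ∀ x ∈ F, ∀ i, i ∉ T → x i = 0 := fun x hx i hi => by
      rw [← hsupp x hx] at hi
      simpa using hi
    rw [← hTc, ← card_patterns]
    refine card_le_card_of_injOn (fun x i => if i ∈ T then max (x i) ⟨c, hc⟩ else 0)
      (fun x hx => ?_) (fun x hx x' hx' heq => ?_)
    · rw [mem_coe, mem_patterns]
      refine ⟨fun i hi => ?_, fun i hi => by simp [hi]⟩
      simp only [hi, if_true]
      exact (le_max_right (x i) ⟨c, hc⟩ : (⟨c, hc⟩ : Fin (q + 1)) ≤ _)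
    · by_contra hne
      apply hne
      funext i
      by_cases hi : i ∈ T
      · have h2 := congrFun heq i
        simp only [hi, if_true] at h2
        have h3 := hsum x hx x' hx' hne i (mem_univ i) (mem_filter.1 hi).2
        have h4 := congrArg Fin.val h2
        simp only [Fin.coe_max] at h4
        ext
        omega
      · rw [hzero x hx i hi, hzero x' hx' i hi]
  · omega

theorem exists_card_le_of_even {q s r t : ℕ} (hqs : q < s) (hs : s ≤ 2 * q) (h2 : 2 ≤ s)
    (hev : Even s) (htr : t ≤ r) :
    ∃ N : ℕ, ∀ n : ℕ, N ≤ n → ∀ F : Finset (QVec q n), SupportUniform r F →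
      SumIntersecting s t F →
        F.card ≤ (q - s / 2 + 1) ^ t * q ^ (r - t) * (n - t).choose (r - t) := by
  rcases htr.eq_or_lt with rfl | hlt
  · refine ⟨0, fun n _ F hu hi => ?_⟩
    simpa using card_le_of_even_of_eq hqs hs hev (isRelFamily_univ hu hi)
  · have hc : 2 * (s / 2) = s := Nat.two_mul_div_two_of_even hev
    obtain ⟨N, hN⟩ := card_le_or_anchored (b := s / 2) hqs (by omega) (by omega) (by omega) hlt
      le_rfl
    refine ⟨N, fun n hn F hu hi => ?_⟩
    rcases hN n univ F (by simpa using hn) (isRelFamily_univ hu hi) with h | ⟨T, -, hT, h⟩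
    · rw [show q - s / 2 + 1 = q + 1 - s / 2 by omega]
      simpa using h
    · rw [← card_evenFamily h2 hs htr hT]
      refine card_le_card fun z hz => mem_filter.2 ⟨mem_univ _, fun i hi => ?_, hu z hz⟩
      have := h z hz i hi
      omega

theorem evenFamily_supportUniform {n q s r : ℕ} (T : Finset (Fin n)) :
    SupportUniform r (evenFamily n q s r T) :=
  fun _ hx => (mem_filter.1 hx).2.2

theorem evenFamily_sumIntersecting {n q s r : ℕ} (hev : Even s) (T : Finset (Fin n)) :
    SumIntersecting s T.card (evenFamily n q s r T) := by
  intro x hx y hy _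
  refine card_le_card fun i hi => mem_filter.2 ⟨mem_univ _, ?_⟩
  have h1 := (mem_filter.1 hx).2.1 i hi
  have h2 := (mem_filter.1 hy).2.1 i hi
  have hc : 2 * (s / 2) = s := Nat.two_mul_div_two_of_even hev
  omega

/-! ### The counting function for odd s -/

/-- The size of the main part of the extremal family for odd `s` on `N` coordinates, where `p` is
the number of values exceeding `s / 2`. -/
def mainCount (p q : ℕ) : ℕ → ℕ → ℕ → ℕ
  | N, r, 0 => q ^ r * N.choose r
  | _, 0, _ + 1 => 0
  | N, r + 1, t + 1 => p * mainCount p q (N - 1) r t + mainCount p q (N - 1) r (t + 1)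

theorem mainCount_zero (p q N r : ℕ) : mainCount p q N r 0 = q ^ r * N.choose r := by
  cases r <;> rw [mainCount]

/-- Unrolls the recursion `T.card` times, `D` recording the steps that take a large value. Only the
cardinality of `T` matters, so an arbitrary anchor may be used. -/
theorem mainCount_eq_sum_powerset {α : Type*} [DecidableEq α] (p q N r t : ℕ) (T : Finset α)
    (ht : T.card ≤ t) (hr : T.card ≤ r) :
    mainCount p q N r t = ∑ D ∈ T.powerset,
      p ^ D.card * mainCount p q (N - T.card) (r - T.card) (t - D.card) := by
  induction T using Finset.induction_on with
  | empty => simp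
  | insert a T ha ih =>
    rw [card_insert_of_notMem ha] at ht hr ⊢
    rw [ih (by omega) (by omega), sum_powerset_insert ha, ← sum_add_distrib]
    refine sum_congr rfl fun D hD => ?_
    have hDT := mem_powerset.1 hD
    have hDc := card_le_card hDT
    rw [card_insert_of_notMem fun h => ha (hDT h)]
    obtain ⟨r', hr'⟩ : ∃ r', r - T.card = r' + 1 := ⟨r - T.card - 1, by omega⟩
    obtain ⟨t', ht'⟩ : ∃ t', t - D.card = t' + 1 := ⟨t - D.card - 1, by omega⟩
    rw [hr', ht', mainCount, show N - (T.card + 1) = N - T.card - 1 by omega,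
      show r - (T.card + 1) = r' by omega, show t - (D.card + 1) = t' by omega]
    ring

/-- Keeps only the term in which the first `t` entries are all large. -/
theorem le_mainCount (p q N : ℕ) {r t : ℕ} (h : t ≤ r) :
    p ^ t * q ^ (r - t) * (N - t).choose (r - t) ≤ mainCount p q N r t := by
  rw [mainCount_eq_sum_powerset p q N r t (range t) (by simp) (by simpa using h)]
  refine le_trans (le_of_eq ?_) (single_le_sum (fun _ _ => Nat.zero_le _)
    (mem_powerset_self (range t)))
  simp [mainCount_zero, mul_assoc]

/-- Vandermonde for r = t + (r - t), with `D` the part chosen inside `T`. The `if` removes D = T,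
where truncated subtraction would contribute a spurious 1. -/
theorem choose_eq_sum_powerset {α : Type*} [DecidableEq α] {r t : ℕ} {T : Finset α}
    (hT : T.card = t) (ht : 1 ≤ t) (htr : t ≤ r) :
    r.choose (t - 1) =
      ∑ D ∈ T.powerset, if D.card < t then (r - t).choose (t - D.card - 1) else 0 := by
  rw [sum_powerset_apply_card (fun d => if d < t then (r - t).choose (t - d - 1) else 0), hT,
    sum_range_succ]
  simp only [lt_irrefl, if_false, smul_zero, add_zero]
  conv_lhs => rw [show r = t + (r - t) by omega]
  rw [Nat.add_choose_eq, Nat.sum_antidiagonal_eq_sum_range_succ_mk,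
    show (t - 1).succ = t by omega]
  refine sum_congr rfl fun d hd => ?_
  have hd' := mem_range.1 hd
  rw [if_pos hd', smul_eq_mul, show t - d - 1 = t - 1 - d by omega]

/-! ### The upper bound for odd s -/

/-- Members with all entries on the common support above c give the main term. Any other member has
an entry at most c there, and two members cannot share such a coordinate, so there are at most t of
them. -/
theorem card_le_of_odd_of_eq {q n s c t l : ℕ} (hsc : s = 2 * c + 1) (hqs : q < s) (ht : 1 ≤ t)
    {U : Finset (Fin n)} {F : Finset (QVec q n)} (hF : IsRelFamily s t t l U F) :
    F.card ≤ l * (q - c) ^ t + t := by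
  rcases Nat.lt_or_ge 1 F.card with h1 | h1
  · obtain ⟨y, hy⟩ := card_pos.1 (lt_trans one_pos h1)
    obtain ⟨-, hsum⟩ := exists_common_support hqs hF hy
    have hTc := hF.uniform y hy
    have hTU : (U.filter fun i => y i ≠ 0) ⊆ U := filter_subset _ _
    have hTs : ∀ x ∈ F, ∀ x' ∈ F, x ≠ x' → ∀ i ∈ U.filter fun i => y i ≠ 0,
        s ≤ (x i : ℕ) + (x' i : ℕ) := fun x hx x' hx' hne i hi =>
      hsum x hx x' hx' hne i (hTU hi) (mem_filter.1 hi).2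
    set T := U.filter fun i => y i ≠ 0
    rw [← card_filter_add_card_filter_not (s := F) fun x => ∀ i ∈ T, c + 1 ≤ (x i : ℕ)]
    refine add_le_add ?_ ?_
    · have hsub : (F.filter fun x => ∀ i ∈ T, c + 1 ≤ (x i : ℕ)) ⊆ F := filter_subset _ _
      have := card_le_of_prescribed (hF.mono hsub).uniform (hF.mono hsub).mult hTU
        (fun _ => univ.filter fun v => c + 1 ≤ (v : ℕ)) (fun i _ => by simp) hTc.le
        (fun x hx i hi => by simpa using (mem_filter.1 hx).2 i hi)
      rw [prod_const, card_filter_le_val, hTc] at this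
      simpa using this
    · have hex : ∀ x ∈ F.filter fun x => ¬ ∀ i ∈ T, c + 1 ≤ (x i : ℕ),
          ∃ i ∈ T, (x i : ℕ) ≤ c := fun x hx => by
        have := (mem_filter.1 hx).2
        push Not at this
        obtain ⟨i, hi, h⟩ := this
        exact ⟨i, hi, by omega⟩
      obtain ⟨i₀, -⟩ := card_pos.1 (hTc ▸ ht : 0 < T.card)
      have : Nonempty (Fin n) := ⟨i₀⟩
      choose! g hgT hgc using hex
      rw [← hTc]
      refine card_le_card_of_injOn g (fun x hx => hgT x hx) fun x hx x' hx' heq => ?_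
      by_contra hne
      have h2 := hTs x (mem_filter.1 hx).1 x' (mem_filter.1 hx').1 hne (g x) (hgT x hx)
      have h3 := hgc x hx
      have h4 := hgc x' hx'
      rw [← heq] at h4
      omega
  · omega

/-- The part of an anchored family with a given set `D` of large entries on the anchor is again a
relative family on the remaining coordinates. -/
theorem IsRelFamily.restrict {q n s c r t l : ℕ} (hsc : s = 2 * c + 1) (hc : 1 ≤ c)
    {U T D : Finset (Fin n)} {F : Finset (QVec q n)} (hF : IsRelFamily s r t l U F) (hTU : T ⊆ U)
    (hT : T.card = t) (hDT : D ⊆ T) (hanc : ∀ z ∈ F, ∀ i ∈ T, c ≤ (z i : ℕ))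
    (hD : ∀ z ∈ F, (T.filter fun i => c < (z i : ℕ)) = D) :
    IsRelFamily s (r - t) (t - D.card) (l * (q - c) ^ D.card) (U \ T) F where
  uniform x hx := by
    have h : (T.filter fun i => x i ≠ 0) = T := filter_true_of_mem fun i hi h => by
      have := hanc x hx i hi
      rw [h, Fin.val_zero] at this
      omega
    have h2 := hF.uniform x hx
    have hd : Disjoint (T.filter fun i => x i ≠ 0) ((U \ T).filter fun i => x i ≠ 0) :=
      disjoint_filter_filter disjoint_sdiff
    have hun : U = T ∪ (U \ T) := (union_sdiff_of_subset hTU).symm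
    rw [hun, filter_union, card_union_of_disjoint hd, h, hT] at h2
    omega
  inter x hx y hy hxy := by
    have h2 := hF.inter x hx y hy hxy
    have hd : Disjoint (T.filter fun i => s ≤ (x i : ℕ) + (y i : ℕ))
        ((U \ T).filter fun i => s ≤ (x i : ℕ) + (y i : ℕ)) :=
      disjoint_filter_filter disjoint_sdiff
    have hun : U = T ∪ (U \ T) := (union_sdiff_of_subset hTU).symm
    rw [hun, filter_union, card_union_of_disjoint hd] at h2
    have h3 : (T.filter fun i => s ≤ (x i : ℕ) + (y i : ℕ)) ⊆ D := by
      intro i hi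
      obtain ⟨hiT, hs⟩ := mem_filter.1 hi
      by_contra hiD
      have hx' := hiD
      have hy' := hiD
      rw [← hD x hx, mem_filter, not_and] at hx'
      rw [← hD y hy, mem_filter, not_and] at hy'
      have := hx' hiT
      have := hy' hiT
      omega
    have := card_le_card h3
    omega
  mult w := by
    -- Once the entries on U \ T are fixed, only those in `D` are free, since those in T \ D equal
    -- c.
    have hG : (Fintype.piFinset fun i : Fin n =>
        if i ∈ D then (univ.filter fun v : Fin (q + 1) => c + 1 ≤ (v : ℕ)) else
          if i ∈ T then univ.filter (fun v : Fin (q + 1) => (v : ℕ) = c) else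
            if i ∈ U then {w i} else {0}).card ≤ (q - c) ^ D.card := by
      rw [Fintype.card_piFinset, ← prod_mul_prod_compl D]
      have h1 : ∀ i ∈ Dᶜ, (if i ∈ D then (univ.filter fun v : Fin (q + 1) => c + 1 ≤ (v : ℕ)) else
          if i ∈ T then univ.filter (fun v : Fin (q + 1) => (v : ℕ) = c) else
            if i ∈ U then {w i} else {0}).card ≤ 1 := by
        intro i hi
        rw [if_neg (mem_compl.1 hi)]
        split_ifs
        · refine card_le_one.2 fun a ha b hb => Fin.ext ?_
          rw [(mem_filter.1 ha).2, (mem_filter.1 hb).2]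
        · simp
        · simp
      refine (Nat.mul_le_mul_left _ (prod_le_one (fun _ _ => Nat.zero_le _) h1)).trans ?_
      rw [mul_one]
      refine le_of_eq ?_
      rw [← prod_const]
      refine prod_congr rfl fun i hi => ?_
      rw [if_pos hi, card_filter_le_val]
      omega
    refine le_trans ?_ (Nat.mul_le_mul_left l hG)
    refine card_le_of_restrictTo_mem (hF.mono (filter_subset _ F)).mult fun x hx => ?_
    obtain ⟨hxF, hxw⟩ := mem_filter.1 hx
    have hDx := hD x hxF
    rw [Fintype.mem_piFinset]
    intro i
    by_cases hiD : i ∈ D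
    · have h1 := hiD
      rw [← hDx, mem_filter] at h1
      simp only [hiD, if_true, restrictTo, hTU (hDT hiD), mem_filter, mem_univ, true_and]
      exact h1.2
    · by_cases hiT : i ∈ T
      · have h1 := hiD
        rw [← hDx, mem_filter, not_and] at h1
        simp only [hiD, if_false, hiT, if_true, restrictTo, hTU hiT, mem_filter, mem_univ,
          true_and]
        exact le_antisymm (not_lt.1 (h1 hiT)) (hanc x hxF i hiT)
      · by_cases hiU : i ∈ U
        · simpa [hiD, hiT, hiU, restrictTo] using hxw i (mem_sdiff.2 ⟨hiU, hiT⟩)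
        · simp [hiD, hiT, hiU, restrictTo]

/-- In an anchored family, the members with few large entries on the anchor are few. -/
theorem card_few_large_le {q n s c r t l : ℕ} (hsc : s = 2 * c + 1) (htr : t ≤ r)
    {U T : Finset (Fin n)} {F : Finset (QVec q n)} (hF : IsRelFamily s r t l U F) (hTU : T ⊆ U)
    (hT : T.card = t) (hqs : q < s) (hc : 1 ≤ c) (hanc : ∀ z ∈ F, ∀ i ∈ T, c ≤ (z i : ℕ)) :
    (F.filter fun z => (T.filter fun i => c < (z i : ℕ)).card < t - (r - t)).card ≤
      ∑ D ∈ T.powerset.filter (fun D => D.card < t - (r - t)),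
        if D.card < t then (r - t).choose (t - D.card - 1) else 0 := by
  set P := F.filter fun z => (T.filter fun i => c < (z i : ℕ)).card < t - (r - t) with hP
  rcases P.eq_empty_or_nonempty with hPe | ⟨z₀, hz₀⟩
  · simp [hPe]
  have hk : 1 ≤ t - (r - t) := by
    have := (mem_filter.1 hz₀).2
    omega
  set k := t - (r - t) - 1 with hkd
  have hex : ∀ z ∈ P, ∃ E, (T.filter fun i => c < (z i : ℕ)) ⊆ E ∧ E ⊆ T ∧ E.card = k :=
    fun z hz => exists_subsuperset_card_eq (filter_subset _ _)
      (by have := (mem_filter.1 hz).2; omega) (by omega)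
  choose! g hg1 hg2 hg3 using hex
  -- Two members with the same extension would meet in at most k coordinates of `T` and r - t
  -- outside it, which is t - 1 in total.
  have h1 : P.card ≤ (T.powersetCard k).card := by
    refine card_le_card_of_injOn g (fun z hz => mem_powersetCard.2 ⟨hg2 z hz, hg3 z hz⟩)
      fun x hx y hy heq => ?_
    by_contra hne
    have hxF := (mem_filter.1 hx).1
    have h2 := hF.inter x hxF y (mem_filter.1 hy).1 hne
    have hout : ((U.filter fun i => x i ≠ 0) \ T).card = r - t := by
      rw [card_sdiff_of_subset, hF.uniform x hxF, hT]
      intro i hi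
      refine mem_filter.2 ⟨hTU hi, fun h => ?_⟩
      have := hanc x hxF i hi
      rw [h, Fin.val_zero] at this
      omega
    have hsub : (U.filter fun i => s ≤ (x i : ℕ) + (y i : ℕ)) ⊆
        g x ∪ ((U.filter fun i => x i ≠ 0) \ T) := by
      intro i hi
      obtain ⟨hiU, hs⟩ := mem_filter.1 hi
      by_cases hiT : i ∈ T
      · refine mem_union_left _ ?_
        rcases lt_or_ge c (x i : ℕ) with h | h
        · exact hg1 x hx (mem_filter.2 ⟨hiT, h⟩)
        · rw [heq]
          exact hg1 y hy (mem_filter.2 ⟨hiT, by omega⟩)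
      · exact mem_union_right _ (mem_sdiff.2
          ⟨mem_filter.2 ⟨hiU, (ne_zero_of_le_add hqs hs).1⟩, hiT⟩)
    have h3 := (card_le_card hsub).trans (card_union_le _ _)
    rw [hg3 x hx, hout] at h3
    omega
  refine h1.trans ?_
  rw [card_eq_sum_ones]
  -- Only the terms with |D| = k are needed; there t - k - 1 = r - t and the binomial is 1.
  refine le_trans (le_of_eq ?_) (sum_le_sum_of_subset (s := T.powersetCard k) ?_)
  · refine sum_congr rfl fun D hD => ?_
    have := (mem_powersetCard.1 hD).2
    rw [if_pos (by omega), show t - D.card - 1 = r - t by omega, Nat.choose_self]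
  · intro D hD
    rw [mem_powersetCard] at hD
    exact mem_filter.2 ⟨mem_powerset.2 hD.1, by omega⟩

/-- Strong induction on `r`, for all `t` and `l` at once, because passing to the complement of the
anchor changes all three. -/
theorem exists_card_le_of_odd {q s c : ℕ} (hsc : s = 2 * c + 1) (hqs : q < s) (hs : s ≤ 2 * q)
    (r : ℕ) : ∀ t l : ℕ, 1 ≤ t → t ≤ r → 1 ≤ l →
    ∃ N : ℕ, ∀ (n : ℕ) (U : Finset (Fin n)) (F : Finset (QVec q n)), N ≤ U.card →
      IsRelFamily s r t l U F →
        F.card ≤ l * mainCount (q - c) q U.card r t + r.choose (t - 1) := by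
  induction r using Nat.strong_induction_on with
  | _ r ih =>
  intro t l ht htr hl
  have hc : 1 ≤ c := by omega
  rcases htr.eq_or_lt with rfl | hlt
  · refine ⟨0, fun n U F _ hF => ?_⟩
    have h1 := card_le_of_odd_of_eq hsc hqs ht hF
    have h2 := Nat.mul_le_mul_left l (le_mainCount (q - c) q U.card (le_refl t))
    rw [Nat.choose_symm (n := t) (k := 1) ht, Nat.choose_one_right]
    simp only [Nat.sub_self, pow_zero, Nat.choose_zero_right, mul_one] at h2
    omega
  obtain ⟨N₀, hN₀⟩ := card_le_or_anchored (b := c + 1) hqs (by omega) (by omega) (by omega) hlt hl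
  -- One threshold per size d of `D`; for sizes outside the induction the threshold 0 is a dummy.
  have hIH : ∀ d : ℕ, ∃ N : ℕ, d < t → t - d ≤ r - t → ∀ (n : ℕ) (U : Finset (Fin n))
      (F : Finset (QVec q n)), N ≤ U.card →
      IsRelFamily s (r - t) (t - d) (l * (q - c) ^ d) U F →
        F.card ≤ l * (q - c) ^ d * mainCount (q - c) q U.card (r - t) (t - d) +
          (r - t).choose (t - d - 1) := by
    intro d
    by_cases hd : d < t ∧ t - d ≤ r - t
    · obtain ⟨N, hN⟩ := ih (r - t) (by omega) (t - d) (l * (q - c) ^ d) (by omega) hd.2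
        (Nat.mul_pos hl (Nat.pow_pos (by omega)))
      exact ⟨N, fun _ _ => hN⟩
    · exact ⟨0, fun h1 h2 => absurd ⟨h1, h2⟩ hd⟩
  choose N₁ hN₁ using hIH
  refine ⟨N₀ + t + (range t).sup N₁, fun n U F hU hF => ?_⟩
  rcases hN₀ n U F (by omega) hF with h | ⟨T, hTU, hT, hanc⟩
  · refine h.trans ((Nat.mul_le_mul_left l ?_).trans (Nat.le_add_right _ _))
    rw [show q + 1 - (c + 1) = q - c by omega]
    exact le_mainCount _ _ _ htr
  replace hanc : ∀ z ∈ F, ∀ i ∈ T, c ≤ (z i : ℕ) := fun z hz i hi => by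
    have := hanc z hz i hi
    omega
  have hUT : (U \ T).card = U.card - t := by rw [card_sdiff_of_subset hTU, hT]
  have hrich : ∀ D ∈ T.powerset.filter (fun D => ¬ D.card < t - (r - t)),
      (F.filter fun z => (T.filter fun i => c < (z i : ℕ)) = D).card ≤
        l * ((q - c) ^ D.card * mainCount (q - c) q (U.card - t) (r - t) (t - D.card)) +
          if D.card < t then (r - t).choose (t - D.card - 1) else 0 := by
    intro D hD
    obtain ⟨hDT, hDc⟩ := mem_filter.1 hD
    rw [mem_powerset] at hDT
    have hsub : (F.filter fun z => (T.filter fun i => c < (z i : ℕ)) = D) ⊆ F := filter_subset _ _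
    have hrel := (hF.mono hsub).restrict hsc hc hTU hT hDT (fun z hz => hanc z (hsub hz))
      (fun z hz => (mem_filter.1 hz).2)
    rw [← hUT, ← mul_assoc]
    split_ifs with hDt
    · refine hN₁ D.card hDt (by omega) n (U \ T) _ ?_ hrel
      have := le_sup (f := N₁) (mem_range.2 hDt)
      omega
    -- For D = T nothing is left to intersect outside the anchor, and the trivial count of all
    -- supports of size r - t suffices.
    · have hDt' : D.card = t := le_antisymm (hT ▸ card_le_card hDT) (not_lt.1 hDt)
      have := card_le_of_prescribed hrel.uniform hrel.mult (empty_subset (U \ T))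
        (fun _ => ∅) (by simp) (by simp) (by simp)
      simpa [hDt', mainCount_zero] using this
  have hsplit := card_filter_add_card_filter_not (s := F)
    fun z => (T.filter fun i => c < (z i : ℕ)).card < t - (r - t)
  have hfib : (F.filter fun z => ¬ (T.filter fun i => c < (z i : ℕ)).card < t - (r - t)).card ≤
      ∑ D ∈ T.powerset.filter (fun D => ¬ D.card < t - (r - t)),
        (F.filter fun z => (T.filter fun i => c < (z i : ℕ)) = D).card := by
    rw [card_eq_sum_card_fiberwise (f := fun z : QVec q n => T.filter fun i => c < (z i : ℕ))
      (t := T.powerset.filter (fun D => ¬ D.card < t - (r - t)))]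
    · exact sum_le_sum fun D _ => card_le_card (filter_subset_filter _ (filter_subset _ _))
    · intro z hz
      exact mem_coe.2 (mem_filter.2 ⟨mem_powerset.2 (filter_subset _ _), (mem_filter.1 hz).2⟩)
  have hfew := card_few_large_le hsc htr hF hTU hT hqs hc hanc
  have h1 := hfib.trans (sum_le_sum hrich)
  rw [sum_add_distrib, ← mul_sum] at h1
  -- Both parts of the target become sums over D ⊆ T, to be compared with the bounds for the
  -- classes.
  rw [choose_eq_sum_powerset hT ht htr,
    mainCount_eq_sum_powerset (q - c) q U.card r t T hT.le (hT.trans_le htr), hT,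
    ← sum_filter_add_sum_filter_not T.powerset (fun D => D.card < t - (r - t))
      fun D => if D.card < t then (r - t).choose (t - D.card - 1) else 0]
  have h2 : l * ∑ D ∈ T.powerset.filter (fun D => ¬ D.card < t - (r - t)),
      (q - c) ^ D.card * mainCount (q - c) q (U.card - t) (r - t) (t - D.card) ≤
      l * ∑ D ∈ T.powerset,
        (q - c) ^ D.card * mainCount (q - c) q (U.card - t) (r - t) (t - D.card) :=
    Nat.mul_le_mul_left l (sum_le_sum_of_subset (filter_subset _ _))
  omega

/-! ### The extremal families for odd s -/

/-- Sorts by the position `j`, counted from 0, of the last required large entry: the other `t` lie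
among the `j` earlier positions, and everything after it is free. -/
theorem mainCount_eq_sum_range (p q : ℕ) (N r t : ℕ) :
    mainCount p q N r (t + 1) = ∑ j ∈ range r,
      j.choose t * (p ^ (t + 1) * q ^ (r - (j + 1)) * (N - (j + 1)).choose (r - (j + 1))) := by
  induction r generalizing N t with
  | zero => simp [mainCount]
  | succ r ih =>
    rw [sum_range_succ', mainCount, ih]
    have hsub : ∀ j, N - (j + 1 + 1) = N - 1 - (j + 1) := fun j => by omega
    cases t with
    | zero =>
      rw [mainCount_zero]
      simp only [Nat.choose_zero_right, one_mul, Nat.add_sub_add_right, hsub]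
      simp only [zero_add, Nat.sub_zero]
      ring
    | succ t =>
      rw [ih, mul_sum, ← sum_add_distrib]
      simp only [Nat.choose_zero_succ, zero_mul, add_zero]
      refine sum_congr rfl fun j _ => ?_
      rw [Nat.choose_succ_succ, Nat.add_sub_add_right, hsub]
      ring

theorem firstCoords_succ {n r : ℕ} (hr : r < n) :
    firstCoords n (r + 1) = insert ⟨r, hr⟩ (firstCoords n r) := by
  ext i
  simp only [firstCoords, mem_filter, mem_univ, true_and, mem_insert, Fin.ext_iff]
  omega

theorem card_firstCoords {n r : ℕ} (hr : r ≤ n) : (firstCoords n r).card = r := by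
  rw [firstCoords, Fin.card_filter_val_lt, min_eq_right hr]

/-- The coordinates that do not exceed all elements of `T`. -/
def downSet {n : ℕ} (T : Finset (Fin n)) : Finset (Fin n) :=
  univ.filter fun i => ∃ j ∈ T, i ≤ j

theorem subset_downSet {n : ℕ} (T : Finset (Fin n)) : T ⊆ downSet T := fun i hi =>
  mem_filter.2 ⟨mem_univ i, i, hi, le_rfl⟩

theorem downSet_subset_firstCoords {n r : ℕ} {T : Finset (Fin n)} (h : T ⊆ firstCoords n r) :
    downSet T ⊆ firstCoords n r := by
  intro i hi
  obtain ⟨j, hj, hij⟩ := (mem_filter.1 hi).2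
  have := (mem_filter.1 (h hj)).2
  exact mem_filter.2 ⟨mem_univ i, lt_of_le_of_lt hij this⟩

theorem downSet_insert {n r : ℕ} (hr : r < n) {T : Finset (Fin n)} (h : T ⊆ firstCoords n r) :
    downSet (insert ⟨r, hr⟩ T) = firstCoords n (r + 1) := by
  refine (downSet_subset_firstCoords ?_).antisymm fun i hi => ?_
  · rw [firstCoords_succ hr]
    exact insert_subset_insert _ h
  · refine mem_filter.2 ⟨mem_univ i, ⟨r, hr⟩, mem_insert_self _ _, ?_⟩
    exact Nat.lt_succ_iff.1 (mem_filter.1 hi).2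

/-- Groups the sets by their largest element `j`, whose down-set has j + 1 elements. -/
theorem sum_powersetCard_downSet {n r : ℕ} (hr : r ≤ n) (t : ℕ) (g : ℕ → ℕ) :
    ∑ T ∈ (firstCoords n r).powersetCard (t + 1), g (downSet T).card =
      ∑ j ∈ range r, j.choose t * g (j + 1) := by
  induction r with
  | zero =>
    rw [powersetCard_eq_empty.2 (by rw [card_firstCoords hr]; omega)]
    simp
  | succ r ih =>
    have hnot : (⟨r, hr⟩ : Fin n) ∉ firstCoords n r := by simp [firstCoords]
    rw [firstCoords_succ hr, powersetCard_succ_insert hnot, sum_union, ih (by omega),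
      sum_range_succ, sum_image]
    · congr 1
      rw [sum_congr rfl (g := fun _ => g (r + 1)), sum_const, card_powersetCard,
        card_firstCoords (by omega), smul_eq_mul]
      intro T hT
      rw [downSet_insert hr (mem_powersetCard.1 hT).1, card_firstCoords hr]
    · intro T hT T' hT' heq
      have h1 : (⟨r, hr⟩ : Fin n) ∉ T := fun h => hnot ((mem_powersetCard.1 hT).1 h)
      have h2 : (⟨r, hr⟩ : Fin n) ∉ T' := fun h => hnot ((mem_powersetCard.1 hT').1 h)
      rw [← erase_insert h1, ← erase_insert h2]
      exact congrArg (fun X : Finset (Fin n) => X.erase ⟨r, hr⟩) heq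
    · rw [disjoint_left]
      intro T hT hT'
      obtain ⟨T₀, -, rfl⟩ := mem_image.1 hT'
      exact hnot ((mem_powersetCard.1 hT).1 (mem_insert_self _ _))

/-- Of two finite sets of coordinates, one is contained in the down-set of the other. -/
theorem subset_downSet_or {n : ℕ} (T T' : Finset (Fin n)) :
    T ⊆ downSet T' ∨ T' ⊆ downSet T := by
  by_contra! h
  obtain ⟨⟨i, hi, hi'⟩, ⟨j, hj, hj'⟩⟩ := not_subset.1 h.1, not_subset.1 h.2
  simp only [downSet, mem_filter, mem_univ, true_and, not_exists, not_and, not_le] at hi' hj'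
  exact lt_asymm (hi' j hj) (hj' i hi)

theorem mem_oddFamilyMain {n q s r t : ℕ} {y : QVec q n} :
    y ∈ oddFamilyMain n q s r t ↔ ∃ T ⊆ firstCoords n r, T.card = t ∧
      (∀ i ∈ T, s / 2 < (y i : ℕ)) ∧ (∀ i ∈ downSet T, i ∉ T → (y i : ℕ) = s / 2) ∧
      (supp y).card = r := by
  simp only [oddFamilyMain, mem_biUnion, mem_powersetCard, mem_filter, mem_univ, true_and,
    downSet]
  constructor
  · rintro ⟨T, ⟨h1, h2⟩, h3, h4, h5⟩
    exact ⟨T, h1, h2, h3, fun i hi hiT => h4 i hiT hi, h5⟩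
  · rintro ⟨T, h1, h2, h3, h4, h5⟩
    exact ⟨T, ⟨h1, h2⟩, h3, fun i hiT hi => h4 i hi hiT, h5⟩

/-- The pieces are disjoint: if T lies in the down-set of T' and one vector belongs to both, its
entries on T are too large to lie outside T', so T ⊆ T' and the sets coincide. -/
theorem card_oddFamilyMain {n q s r t : ℕ} (hs : 2 ≤ s) (hsq : s ≤ 2 * q) (hrn : r ≤ n) :
    (oddFamilyMain n q s r (t + 1)).card = mainCount (q - s / 2) q n r (t + 1) := by
  rw [oddFamilyMain, card_biUnion]
  · rw [mainCount_eq_sum_range, ← sum_powersetCard_downSet hrn t fun m =>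
      (q - s / 2) ^ (t + 1) * q ^ (r - m) * (n - m).choose (r - m)]
    refine sum_congr rfl fun T hT => ?_
    obtain ⟨hTr, hTc⟩ := mem_powersetCard.1 hT
    have hdr : (downSet T).card ≤ r :=
      (card_le_card (downSet_subset_firstCoords hTr)).trans (card_firstCoords hrn).le
    have h := card_prescribed (q := q) (subset_univ (downSet T))
      (fun i => if i ∈ T then univ.filter fun v => s / 2 + 1 ≤ (v : ℕ)
        else univ.filter fun v => (v : ℕ) = s / 2)
      (fun i _ => by
        split_ifs
        · simp
        · simp only [mem_filter, mem_univ, true_and, Fin.val_zero]; omega) hdr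
    have hprod : ∏ i ∈ downSet T, (if i ∈ T then
        univ.filter fun v : Fin (q + 1) => s / 2 + 1 ≤ (v : ℕ) else
          univ.filter fun v => (v : ℕ) = s / 2).card = (q - s / 2) ^ (t + 1) := by
      rw [← prod_subset (subset_downSet T), ← hTc, ← prod_const]
      · refine prod_congr rfl fun i hi => ?_
        rw [if_pos hi, card_filter_le_val]
        omega
      · intro i _ hi
        rw [if_neg hi, card_eq_one]
        refine ⟨⟨s / 2, by omega⟩, ?_⟩
        ext v
        simp [Fin.ext_iff]
    rw [hprod, card_univ, Fintype.card_fin] at h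
    rw [← h]
    congr 1
    ext y
    simp only [mem_filter, mem_univ, true_and, not_true_eq_false, false_implies, implies_true]
    constructor
    · rintro ⟨h1, h2, h3⟩
      refine ⟨fun i hi => ?_, h3⟩
      by_cases hiT : i ∈ T
      · simpa [hiT] using h1 i hiT
      · simpa [hiT] using h2 i hiT (mem_filter.1 hi).2
    · rintro ⟨h1, h2⟩
      refine ⟨fun i hi => ?_, fun i hiT hi => ?_, h2⟩
      · have := h1 i (subset_downSet T hi)
        simpa [hi, Nat.succ_le_iff] using this
      · have := h1 i (mem_filter.2 ⟨mem_univ i, hi⟩)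
        simpa [hiT] using this
  · have key : ∀ T ∈ (firstCoords n r).powersetCard (t + 1),
        ∀ T' ∈ (firstCoords n r).powersetCard (t + 1), T ⊆ downSet T' → ∀ y : QVec q n,
        (∀ i ∈ T, s / 2 < (y i : ℕ)) →
        (∀ i, i ∉ T' → (∃ j ∈ T', i ≤ j) → (y i : ℕ) = s / 2) → T = T' := by
      intro T hT T' hT' hsub y h1 h2
      refine eq_of_subset_of_card_le (fun i hi => ?_)
        ((mem_powersetCard.1 hT').2.trans (mem_powersetCard.1 hT).2.symm).le
      by_contra hiT'
      have h3 := h2 i hiT' (mem_filter.1 (hsub hi)).2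
      have h4 := h1 i hi
      omega
    intro T hT T' hT' hne
    simp only [Function.onFun]
    rw [disjoint_left]
    intro y hy hy'
    obtain ⟨-, h1, h2, -⟩ := mem_filter.1 hy
    obtain ⟨-, h1', h2', -⟩ := mem_filter.1 hy'
    rcases subset_downSet_or T T' with h | h
    · exact hne (key T hT T' hT' h y h1 h2')
    · exact hne (key T' hT' T hT h y h1' h2).symm

theorem isAdmissiblePick_standardPick {n q s r t : ℕ} (hs : 2 ≤ s) (hsq : s ≤ 2 * q)
    (hodd : Odd s) : IsAdmissiblePick n q s r t (standardPick n q s r) := by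
  intro T' hT'
  obtain ⟨hsub, -⟩ := mem_powersetCard.1 hT'
  obtain ⟨c, rfl⟩ := hodd
  have hval : (Fin.ofNat (q + 1) ((2 * c + 1) / 2) : ℕ) = c := by
    rw [Fin.val_ofNat, show (2 * c + 1) / 2 = c by omega, Nat.mod_eq_of_lt (by omega)]
  refine ⟨?_, fun i hi => ?_, fun i hi => ?_⟩
  · ext i
    simp only [supp, firstCoords, mem_filter, mem_univ, true_and]
    by_cases hi : i ∈ T'
    · have hir := (mem_filter.1 (hsub hi)).2
      have hv : (standardPick n q (2 * c + 1) r T' i : ℕ) = q := by simp [standardPick, hi]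
      refine ⟨fun _ => hir, fun _ h0 => ?_⟩
      rw [h0, Fin.val_zero] at hv
      omega
    · by_cases hir : (i : ℕ) < r
      · have hv : (standardPick n q (2 * c + 1) r T' i : ℕ) = c := by
          simp only [standardPick, hi, if_false, hir, if_true, hval]
        refine ⟨fun _ => hir, fun _ h0 => ?_⟩
        rw [h0, Fin.val_zero] at hv
        omega
      · simp [standardPick, hi, hir]
  · simp only [standardPick, hi, if_true, Fin.val_last]
    omega
  · obtain ⟨hir, hi⟩ := mem_sdiff.1 hi
    simp only [standardPick, hi, if_false, (mem_filter.1 hir).2, if_true, hval]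
    omega

theorem oddFamily_supportUniform {n q s r t : ℕ} (hrn : r ≤ n) {pick : Finset (Fin n) → QVec q n}
    (hp : IsAdmissiblePick n q s r t pick) : SupportUniform r (oddFamily n q s r t pick) := by
  intro x hx
  rcases mem_union.1 hx with h | h
  · obtain ⟨T', hT', rfl⟩ := mem_image.1 h
    rw [(hp T' hT').1, card_firstCoords hrn]
  · obtain ⟨T, -, -, -, -, h⟩ := mem_oddFamilyMain.1 h
    exact h

/-- An admissible choice determines the index set as the set of large entries in `[r]`. -/
theorem IsAdmissiblePick.filter_large {n q s r t : ℕ} {pick : Finset (Fin n) → QVec q n}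
    (hp : IsAdmissiblePick n q s r t pick) {T' : Finset (Fin n)}
    (hT' : T' ∈ (firstCoords n r).powersetCard (t - 1)) :
    ((firstCoords n r).filter fun i => s / 2 < (pick T' i : ℕ)) = T' := by
  obtain ⟨hsub, -⟩ := mem_powersetCard.1 hT'
  obtain ⟨-, h1, h2⟩ := hp T' hT'
  ext i
  rw [mem_filter]
  constructor
  · rintro ⟨hi, hlt⟩
    by_contra hiT
    have := h2 i (mem_sdiff.2 ⟨hi, hiT⟩)
    omega
  · intro hi
    have := h1 i hi
    exact ⟨hsub hi, by omega⟩

/-- A chosen vector has exactly t - 1 large entries in [r], which recover its index, while the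
members of the main part have at least t. -/
theorem card_oddFamily {n q s r t : ℕ} (hs : 2 ≤ s) (hsq : s ≤ 2 * q) (ht : 1 ≤ t)
    (hrn : r ≤ n) {pick : Finset (Fin n) → QVec q n} (hp : IsAdmissiblePick n q s r t pick) :
    (oddFamily n q s r t pick).card = mainCount (q - s / 2) q n r t + r.choose (t - 1) := by
  rw [oddFamily, card_union_of_disjoint, card_image_of_injOn, card_powersetCard,
    card_firstCoords hrn, add_comm]
  · obtain ⟨t, rfl⟩ : ∃ t', t = t' + 1 := ⟨t - 1, by omega⟩
    rw [card_oddFamilyMain hs hsq hrn]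
  · intro T hT T' hT' heq
    rw [← hp.filter_large hT, heq, hp.filter_large hT']
  · rw [disjoint_left]
    intro x hx hx'
    obtain ⟨T', hT', rfl⟩ := mem_image.1 hx
    obtain ⟨T, hTr, hTc, hT, -⟩ := mem_oddFamilyMain.1 hx'
    have hsub : T ⊆ T' := by
      rw [← hp.filter_large hT']
      exact fun i hi => mem_filter.2 ⟨hTr hi, hT i hi⟩
    have := card_le_card hsub
    rw [(mem_powersetCard.1 hT').2] at this
    omega

/-- A sum reaches s = 2c + 1 once one entry exceeds c and the other is at least c. This happens on T
∪ T' for two chosen vectors, on T for a chosen vector and a main one, and on whichever of T, T' lies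
in the other's down-set for two main ones. -/
theorem oddFamily_sumIntersecting {n q s r t : ℕ} (hodd : Odd s)
    {pick : Finset (Fin n) → QVec q n} (hp : IsAdmissiblePick n q s r t pick) :
    SumIntersecting s t (oddFamily n q s r t pick) := by
  have hsc : s = 2 * (s / 2) + 1 := (Nat.two_mul_div_two_add_one_of_odd hodd).symm
  have hsumT : ∀ (T : Finset (Fin n)) (x y : QVec q n), t ≤ T.card →
      (∀ i ∈ T, s ≤ (x i : ℕ) + (y i : ℕ)) → t ≤ sumInter s x y := fun T x y hT h =>
    hT.trans (card_le_card fun i hi => mem_filter.2 ⟨mem_univ i, h i hi⟩)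
  have hge : ∀ T' ∈ (firstCoords n r).powersetCard (t - 1), ∀ i ∈ firstCoords n r,
      s / 2 ≤ (pick T' i : ℕ) := by
    intro T' hT' i hi
    obtain ⟨-, h1, h2⟩ := hp T' hT'
    by_cases hiT : i ∈ T'
    · have := h1 i hiT
      omega
    · exact (h2 i (mem_sdiff.2 ⟨hi, hiT⟩)).ge
  have hpm : ∀ T' ∈ (firstCoords n r).powersetCard (t - 1), ∀ y ∈ oddFamilyMain n q s r t,
      t ≤ sumInter s (pick T') y := by
    intro T' hT' y hy
    obtain ⟨T, hTr, hTc, hT, -⟩ := mem_oddFamilyMain.1 hy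
    refine hsumT T _ _ hTc.ge fun i hi => ?_
    have h1 := hge T' hT' i (hTr hi)
    have h2 := hT i hi
    omega
  have hcomm : ∀ x y : QVec q n, sumInter s x y = sumInter s y x := fun x y => by
    simp only [sumInter, add_comm]
  have hmain : ∀ (x y : QVec q n) (T T' : Finset (Fin n)), T.card = t →
      (∀ i ∈ T, s / 2 < (x i : ℕ)) → (∀ i ∈ T', s / 2 < (y i : ℕ)) →
      (∀ i ∈ downSet T', i ∉ T' → (y i : ℕ) = s / 2) → T ⊆ downSet T' →
      t ≤ sumInter s x y := by
    intro x y T T' hTc hx hy hy' hsub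
    refine hsumT T _ _ hTc.ge fun i hi => ?_
    have h1 := hx i hi
    by_cases hiT : i ∈ T'
    · have := hy i hiT
      omega
    · have := hy' i (hsub hi) hiT
      omega
  intro x hx y hy hxy
  rcases mem_union.1 hx with h | h <;> rcases mem_union.1 hy with h' | h'
  · obtain ⟨T, hT, rfl⟩ := mem_image.1 h
    obtain ⟨T', hT', rfl⟩ := mem_image.1 h'
    have hTT : T ≠ T' := fun h => hxy (by rw [h])
    obtain ⟨hTr, hTc⟩ := mem_powersetCard.1 hT
    obtain ⟨hTr', hTc'⟩ := mem_powersetCard.1 hT'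
    refine hsumT (T ∪ T') _ _ ?_ fun i hi => ?_
    · have hss : T ⊂ T ∪ T' := by
        refine Finset.ssubset_iff_subset_ne.2 ⟨subset_union_left, fun h => hTT ?_⟩
        refine (eq_of_subset_of_card_le ?_ (hTc.trans hTc'.symm).le).symm
        rw [h]
        exact subset_union_right
      have := card_lt_card hss
      omega
    · have h1 := hge T hT i (union_subset hTr hTr' hi)
      have h2 := hge T' hT' i (union_subset hTr hTr' hi)
      rcases mem_union.1 hi with hi | hi
      · have := (hp T hT).2.1 i hi
        omega
      · have := (hp T' hT').2.1 i hi
        omega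
  · obtain ⟨T, hT, rfl⟩ := mem_image.1 h
    exact hpm T hT y h'
  · obtain ⟨T, hT, rfl⟩ := mem_image.1 h'
    rw [hcomm]
    exact hpm T hT x h
  · obtain ⟨T, -, hTc, hT1, hT2, -⟩ := mem_oddFamilyMain.1 h
    obtain ⟨T', -, hTc', hT1', hT2', -⟩ := mem_oddFamilyMain.1 h'
    rcases subset_downSet_or T T' with hs | hs
    · exact hmain x y T T' hTc hT1 hT1' hT2' hs
    · rw [hcomm]
      exact hmain y x T' T hTc' hT1' hT1 hT2 hs

end

end QVec

theorem mainTheorem3 (q s r t : ℕ) (hq : 2 ≤ q) (hqs : q < s) (hs : s ≤ 2 * q)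
    (ht : 1 ≤ t) (htr : t ≤ r) :
    -- upper bounds for all large `n`
    (∃ N : ℕ, ∀ n : ℕ, N ≤ n → ∀ F : Finset (QVec q n),
      QVec.SupportUniform r F → QVec.SumIntersecting s t F →
        (Even s → F.card ≤ (q - s / 2 + 1) ^ t * q ^ (r - t) * (n - t).choose (r - t)) ∧
        (Odd s → F.card ≤ QVec.f n q s r t)) ∧
    -- the bounds are attained by the constructions
    (∀ n : ℕ, r ≤ n →
      (Even s → ∀ T : Finset (Fin n), T.card = t →
        QVec.SupportUniform r (QVec.evenFamily n q s r T) ∧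
        QVec.SumIntersecting s t (QVec.evenFamily n q s r T) ∧
        (QVec.evenFamily n q s r T).card =
          (q - s / 2 + 1) ^ t * q ^ (r - t) * (n - t).choose (r - t)) ∧
      (Odd s →
        QVec.IsAdmissiblePick n q s r t (QVec.standardPick n q s r) ∧
        ∀ pick : Finset (Fin n) → QVec q n, QVec.IsAdmissiblePick n q s r t pick →
          QVec.SupportUniform r (QVec.oddFamily n q s r t pick) ∧
          QVec.SumIntersecting s t (QVec.oddFamily n q s r t pick) ∧
          (QVec.oddFamily n q s r t pick).card = QVec.f n q s r t)) := by
  have h2s : 2 ≤ s := by omega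
  refine ⟨?_, fun n hrn => ⟨fun hev T hT => ?_, fun hodd => ?_⟩⟩
  · rcases Nat.even_or_odd s with hev | hodd
    · obtain ⟨N, hN⟩ := QVec.exists_card_le_of_even hqs hs h2s hev htr
      exact ⟨N, fun n hn F hu hi =>
        ⟨fun _ => hN n hn F hu hi, fun h => absurd hev (Nat.not_even_iff_odd.2 h)⟩⟩
    · have hsc : s = 2 * (s / 2) + 1 := (Nat.two_mul_div_two_add_one_of_odd hodd).symm
      obtain ⟨N, hN⟩ := QVec.exists_card_le_of_odd hsc hqs hs r t 1 ht htr le_rfl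
      -- The summand `r` ensures r ≤ n, needed to evaluate `QVec.f`.
      refine ⟨N + r, fun n hn F hu hi =>
        ⟨fun h => absurd h (Nat.not_even_iff_odd.2 hodd), fun _ => ?_⟩⟩
      have h := hN n Finset.univ F (by rw [Finset.card_univ, Fintype.card_fin]; omega)
        (QVec.isRelFamily_univ hu hi)
      rw [one_mul, Finset.card_univ, Fintype.card_fin] at h
      rwa [QVec.f, QVec.card_oddFamily h2s hs ht (by omega)
        (QVec.isAdmissiblePick_standardPick h2s hs hodd)]
  · refine ⟨QVec.evenFamily_supportUniform T, ?_, QVec.card_evenFamily h2s hs htr hT⟩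
    rw [← hT]
    exact QVec.evenFamily_sumIntersecting hev T
  · have hstd := QVec.isAdmissiblePick_standardPick (n := n) (r := r) (t := t) h2s hs hodd
    refine ⟨hstd, fun pick hp => ⟨QVec.oddFamily_supportUniform hrn hp,
      QVec.oddFamily_sumIntersecting hodd hp, ?_⟩⟩
    rw [QVec.f, QVec.card_oddFamily h2s hs ht hrn hp, QVec.card_oddFamily h2s hs ht hrn hstd]
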